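/- Let $m<n$ be non-negative integers, let $\mathcal E$ be a linear subspace of $C^\infty(\mathbb{R}^m,\mathbb{R}^n)$, and let $K\subset\mathbb{R}^m$ be a compact set such that $\{f(x):f\in\mathcal E\}=\mathbb{R}^n$ for every $x\in K$. Let $S$ be a (smooth, embedded) submanifold of $\mathbb{R}^n$ whose closure is contained in $S\cup\{0\}$. Then the set of those $f\in\mathcal E$ which have no zeros in $K$ and are transverse to $S$ along $K$ is open and dense in $\mathcal E$ with respect to the smooth weak topology. Here $f$ is called transverse to $S$ along $K$ if $\mathrm df_x(\mathbb{R}^m)+T_{f(x)}S=\mathbb{R}^n$ for every $x\in K$ with $f(x)\in S$. The smooth weak topology on $C^\infty(\mathbb{R}^m,\mathbb{R}^n)$ is the one defined by the seminorms $\|f\|_{L,\alpha}=\sup_{x\in L}\|\partial_\alpha f(x)\|$, where $L$ runs over the compact subsets of $\mathbb{R}^m$ and $\alpha$ over the multi-indices in $\mathbb{N}_0^m$; $\mathcal E$ carries the induced topology. -/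

import Mathlib

open scoped ContDiff Manifold

/-- The space `C^∞(ℝ^m, ℝ^n)` of smooth maps, with its pointwise vector space structure. -/
abbrev SmoothMap (m n : ℕ) : Type :=
  ContMDiffMap 𝓘(ℝ, EuclideanSpace ℝ (Fin m)) 𝓘(ℝ, EuclideanSpace ℝ (Fin n))
    (EuclideanSpace ℝ (Fin m)) (EuclideanSpace ℝ (Fin n)) ∞

/-- The partial derivative `∂_i`, as a linear endomorphism of `C^∞(ℝ^m, ℝ^n)`. -/
noncomputable def SmoothMap.partialDeriv {m n : ℕ} (i : Fin m) :
    Module.End ℝ (SmoothMap m n) where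
  toFun f := ⟨fun x => fderiv ℝ f x (EuclideanSpace.single i 1),
    ((f.contMDiff.contDiff.fderiv_right (m := ∞) le_rfl).clm_apply contDiff_const).contMDiff⟩
  map_add' f g := by
    ext1 x
    have hf := (f.contMDiff.contDiff.differentiable (by simp)) x
    have hg := (g.contMDiff.contDiff.differentiable (by simp)) x
    change fderiv ℝ (⇑f + ⇑g) x _ = fderiv ℝ f x _ + fderiv ℝ g x _
    rw [fderiv_add hf hg]
    rfl
  map_smul' c f := by
    ext1 x
    have hf := (f.contMDiff.contDiff.differentiable (by simp)) x
    change fderiv ℝ (c • ⇑f) x _ = c • fderiv ℝ f x _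
    rw [fderiv_const_smul hf]
    rfl

/-- The partial derivative `∂_α = ∂_1^{α_1} ⋯ ∂_m^{α_m}` for a multi-index `α`. -/
noncomputable def SmoothMap.multiDeriv {m n : ℕ} (α : Fin m → ℕ) :
    Module.End ℝ (SmoothMap m n) :=
  ((List.finRange m).map fun i => SmoothMap.partialDeriv i ^ α i).prod

/-- A smooth map is bounded on a compact set. -/
theorem SmoothMap.bddAbove_norm {m n : ℕ}
    (K : TopologicalSpace.Compacts (EuclideanSpace ℝ (Fin m))) (f : SmoothMap m n) :
    BddAbove (Set.range fun x : K => ‖f x‖) := by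
  have h : Continuous fun x : K => ‖f x‖ :=
    (f.contMDiff.continuous.comp continuous_subtype_val).norm
  have : CompactSpace K := isCompact_iff_compactSpace.mp K.isCompact
  exact (isCompact_range h).bddAbove

/-- The seminorm `f ↦ sup_{x ∈ K} ‖f x‖` for a compact set `K` (it is `0` if `K` is empty). -/
noncomputable def SmoothMap.supSeminorm {m n : ℕ}
    (K : TopologicalSpace.Compacts (EuclideanSpace ℝ (Fin m))) : Seminorm ℝ (SmoothMap m n) :=
  Seminorm.of (fun f => ⨆ x : K, ‖f x‖)
    (fun f g => Real.iSup_le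
      (fun x => (norm_add_le (f x) (g x)).trans (add_le_add
        (le_ciSup (SmoothMap.bddAbove_norm K f) x) (le_ciSup (SmoothMap.bddAbove_norm K g) x)))
      (add_nonneg (Real.iSup_nonneg fun _ => norm_nonneg _)
        (Real.iSup_nonneg fun _ => norm_nonneg _)))
    (fun c f => by
      rw [Real.mul_iSup_of_nonneg (norm_nonneg c)]
      exact iSup_congr fun x => norm_smul c (f x))

/-- The seminorms `‖f‖_{K,α} = sup_{x ∈ K} ‖∂_α f(x)‖`, for `K` compact and `α` a multi-index. -/
noncomputable def SmoothMap.weakSeminorms (m n : ℕ) :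
    SeminormFamily ℝ (SmoothMap m n)
      (TopologicalSpace.Compacts (EuclideanSpace ℝ (Fin m)) × (Fin m → ℕ)) :=
  fun p => (SmoothMap.supSeminorm p.1).comp (SmoothMap.multiDeriv p.2)

/-- The smooth weak topology: the topology defined by the seminorms `‖·‖_{K,α}`. -/
noncomputable instance SmoothMap.smoothWeakTopology (m n : ℕ) :
    TopologicalSpace (SmoothMap m n) :=
  (SmoothMap.weakSeminorms m n).moduleFilterBasis.topology

/-- `S` is a (smooth, embedded) `k`-dimensional submanifold of `ℝ^n`: near each of its points
there is a smooth chart of `ℝ^n` straightening `S` to a `k`-dimensional linear subspace. -/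
def IsSubmanifold {n : ℕ} (k : ℕ) (S : Set (EuclideanSpace ℝ (Fin n))) : Prop :=
  ∀ y ∈ S, ∃ φ : OpenPartialHomeomorph (EuclideanSpace ℝ (Fin n)) (EuclideanSpace ℝ (Fin n)),
    ∃ W : Submodule ℝ (EuclideanSpace ℝ (Fin n)),
      y ∈ φ.source ∧ ContDiffOn ℝ ∞ φ φ.source ∧ ContDiffOn ℝ ∞ φ.symm φ.target ∧
      Module.finrank ℝ W = k ∧ φ '' (S ∩ φ.source) = (W : Set _) ∩ φ.target

/-- The tangent space `T_y S`, spanned by the velocities at `y` of smooth curves in `S`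
through `y` (if `S` is a submanifold, these velocities already form a linear subspace). -/
def tangentSpaceOf {n : ℕ} (S : Set (EuclideanSpace ℝ (Fin n))) (y : EuclideanSpace ℝ (Fin n)) :
    Submodule ℝ (EuclideanSpace ℝ (Fin n)) :=
  Submodule.span ℝ {v | ∃ (γ : ℝ → EuclideanSpace ℝ (Fin n)) (ε : ℝ), 0 < ε ∧
    ContDiffOn ℝ ∞ γ (Set.Ioo (-ε) ε) ∧ (∀ t ∈ Set.Ioo (-ε) ε, γ t ∈ S) ∧
    γ 0 = y ∧ HasDerivAt γ v 0}

/-- `f` is transverse to `S` along `K`: for every `x ∈ K` with `f x ∈ S`, the image of the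
derivative of `f` at `x` and the tangent space of `S` at `f x` together span `ℝ^n`. -/
def TransverseAlong {m n : ℕ} (f : SmoothMap m n) (S : Set (EuclideanSpace ℝ (Fin n)))
    (K : Set (EuclideanSpace ℝ (Fin m))) : Prop :=
  ∀ x ∈ K, f x ∈ S →
    LinearMap.range (fderiv ℝ f x).toLinearMap ⊔ tangentSpaceOf S (f x) = ⊤

/-!
Write the two conditions on `f` as one condition on 1-jets: `(f x, df_x)` lies in the set
`transverseJets` for all `x ∈ K`. This set is open (`isOpen_transverseJets`): in a chart
straightening `S` to `W`, transversality says that a matrix depending continuously on the jet is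
surjective, and outside `S ∪ {0}` there is room because `closure S ⊆ S ∪ {0}`. As evaluation of
1-jets is jointly continuous for the smooth weak topology (`SmoothMap.continuous_jet`) and `K` is
compact, the set of good maps is open. The same holds for every compact set instead of `K`, so that
density only has to be proved locally in the source (`dense_jets`): finite intersections of open
dense sets are dense.

Near `x₀ ∈ K` take `e₁, …, eₙ ∈ E` whose values at `x₀` are the standard basis, let `M x` be the
matrix with columns `eᵢ x`, and perturb `f` to `f_c = f + ∑ cᵢ eᵢ`, that is `f_c x = f x + M x c`.
If `σ` parametrizes a piece of `S` by an open set of `W`, then `f_c x = σ w` means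
`c = (M x)⁻¹ (σ w - f x)`, and differentiating this relation shows that `f_c` is transverse to that
piece as soon as `c` is a regular value of the right hand side, a map of `(x, w)`
(`isMeagre_perturbations_not_transverse_in_chart`). Zeros of `f_c` are treated in the same way with
`σ = 0`; there every point is critical since `m < n`. Countably many charts cover `S`, so it remains
to know that critical values of a smooth map between finite dimensional spaces are meagre
(`isMeagre_image_criticalSet`).

This is Sard's theorem with "meagre" in place of "null" (A. B. Brown). The proof follows the usual
induction on the dimension of the source. Where the derivative is nonzero, one component becomes a
coordinate and the induction applies on its level sets; no Fubini theorem is needed, because a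
compact set whose slices have no interior points has no interior points itself. Where the derivative
vanishes to finite order, the points lie on hypersurfaces, and the induction applies to the
restrictions of the map to these. Where it vanishes to high order, the map satisfies a Hölder
condition with an exponent above the dimension of the source, so that the image has Hausdorff
dimension less than one.
-/

open Set Filter Topology Module
open scoped NNReal
universe u

/-! ### Meagre images and surjective linear maps -/

theorem isMeagre_image_of_locally {X Q : Type*} [TopologicalSpace X] [SecondCountableTopology X]
    [TopologicalSpace Q] {g : X → Q} {A : Set X}
    (h : ∀ x ∈ A, ∃ N ∈ 𝓝 x, IsMeagre (g '' (A ∩ N))) : IsMeagre (g '' A) := by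
  choose! N hN hm using h
  obtain ⟨t, htA, htc, ht⟩ := TopologicalSpace.countable_cover_nhdsWithin
    (fun x hx => mem_nhdsWithin_of_mem_nhds (hN x hx))
  refine (isMeagre_biUnion htc fun x hx => hm x (htA hx)).mono ?_
  rintro _ ⟨x, hx, rfl⟩
  obtain ⟨i, hi, hxi⟩ := mem_iUnion₂.1 (ht hx)
  exact mem_iUnion₂.2 ⟨i, hi, x, ⟨hx, hxi⟩, rfl⟩

theorem IsClosed.isMeagre_of_interior_eq_empty {Q : Type*} [TopologicalSpace Q] {A : Set Q}
    (hA : IsClosed A) (h : interior A = ∅) : IsMeagre A :=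
  (hA.isNowhereDense_iff.2 h).isMeagre

theorem IsMeagre.interior_eq_empty {Q : Type*} [TopologicalSpace Q] [BaireSpace Q] {A : Set Q}
    (h : IsMeagre A) : interior A = ∅ :=
  interior_eq_empty_iff_dense_compl.2 (dense_of_mem_residual h)

theorem isOpen_setOf_surjective {X Q : Type*} [NormedAddCommGroup X] [NormedSpace ℝ X]
    [NormedAddCommGroup Q] [NormedSpace ℝ Q] [FiniteDimensional ℝ Q] :
    IsOpen {L : X →L[ℝ] Q | Function.Surjective L} := by
  rw [isOpen_iff_mem_nhds]
  intro L hL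
  have : CompleteSpace Q := FiniteDimensional.complete ℝ Q
  -- a right inverse of `L` stays a right inverse up to an automorphism for nearby maps
  obtain ⟨R, hR⟩ := L.exists_rightInverse_of_surjective (LinearMap.range_eq_top.2 hL)
  have ho := (ContinuousLinearEquiv.isOpen (𝕜 := ℝ) (E := Q) (F := Q)).preimage
    (f := fun L' : X →L[ℝ] Q => L' ∘L R) (by fun_prop)
  refine mem_of_superset (ho.mem_nhds ⟨ContinuousLinearEquiv.refl ℝ Q, ?_⟩) ?_
  · exact hR.symm
  · rintro L' ⟨e, he⟩ q
    refine ⟨R (e.symm q), ?_⟩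
    have := congrArg (fun T : Q →L[ℝ] Q => T (e.symm q)) he
    simpa using this.symm

theorem ContDiffOn.hasFDerivAt_of_isOpen {X F : Type*} [NormedAddCommGroup X] [NormedSpace ℝ X]
    [NormedAddCommGroup F] [NormedSpace ℝ F] {g : X → F} {U : Set X} (hU : IsOpen U)
    (hg : ContDiffOn ℝ ∞ g U) {x : X} (hx : x ∈ U) : HasFDerivAt g (fderiv ℝ g x) x :=
  ((hg.contDiffAt (hU.mem_nhds hx)).differentiableAt (by simp)).hasFDerivAt

section
variable {X Q : Type u} [NormedAddCommGroup X] [NormedSpace ℝ X]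
  [NormedAddCommGroup Q] [NormedSpace ℝ Q]

/-! ### Maps that are flat on a set -/

/-- The set of points where the derivatives of `h` of order less than `k`, including `h` itself,
vanish. It is defined by passing from `h` to `fderiv ℝ h`, so that `k` and the codomain vary
together in inductions. -/
def flatSet : (k : ℕ) → {F : Type u} → [NormedAddCommGroup F] → [NormedSpace ℝ F] →
    (X → F) → Set X
  | 0, _, _, _, _ => univ
  | k + 1, _, _, _, h => {x | h x = 0} ∩ flatSet k (fderiv ℝ h)

theorem isClosed_inter_flatSet {U N : Set X} (hU : IsOpen U) (hN : IsClosed N) (hNU : N ⊆ U)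
    (k : ℕ) {F : Type u} [NormedAddCommGroup F] [NormedSpace ℝ F] {h : X → F}
    (hh : ContDiffOn ℝ ∞ h U) : IsClosed (N ∩ flatSet k h) := by
  induction k generalizing F with
  | zero => simpa [flatSet] using hN
  | succ k ih =>
    have h1 : IsClosed (N ∩ h ⁻¹' {0}) :=
      (hh.continuousOn.mono hNU).preimage_isClosed_of_isClosed hN isClosed_singleton
    have h2 := ih (hh.fderiv_of_isOpen hU (m := ∞) le_rfl)
    convert h1.inter h2 using 1
    ext x
    change _ ∧ h x = 0 ∧ _ ↔ (_ ∧ h x = 0) ∧ _ ∧ _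
    tauto

/-- A form of Taylor's theorem, by repeated use of the mean value inequality. -/
theorem exists_norm_sub_le_pow_of_flatSet {U N : Set X} (hU : IsOpen U) (hN : IsCompact N)
    (hc : Convex ℝ N) (hNU : N ⊆ U) (k : ℕ) {F : Type u} [NormedAddCommGroup F] [NormedSpace ℝ F]
    {h : X → F} (hh : ContDiffOn ℝ ∞ h U) :
    ∃ M : ℝ, 0 ≤ M ∧ ∀ x ∈ N ∩ flatSet k (fderiv ℝ h), ∀ y ∈ N,
      ‖h y - h x‖ ≤ M * ‖y - x‖ ^ (k + 1) := by
  induction k generalizing F with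
  | zero =>
    have hd := hh.fderiv_of_isOpen hU (m := ∞) le_rfl
    obtain ⟨M, hM⟩ := hN.exists_bound_of_continuousOn (hd.continuousOn.mono hNU)
    refine ⟨max M 0, le_max_right _ _, fun x hx y hy => ?_⟩
    rw [zero_add, pow_one]
    exact hc.norm_image_sub_le_of_norm_fderiv_le (𝕜 := ℝ)
      (fun z hz => (hh.hasFDerivAt_of_isOpen hU (hNU hz)).differentiableAt)
      (fun z hz => (hM z hz).trans (le_max_left _ _)) hx.1 hy
  | succ k ih =>
    obtain ⟨M, hM0, hM⟩ := ih (hh.fderiv_of_isOpen hU (m := ∞) le_rfl)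
    refine ⟨M, hM0, fun x hx y hy => ?_⟩
    have hseg : segment ℝ x y ⊆ N := hc.segment_subset hx.1 hy
    have hx0 : fderiv ℝ h x = 0 := hx.2.1
    rw [pow_succ, ← mul_assoc]
    refine (convex_segment x y).norm_image_sub_le_of_norm_fderiv_le (𝕜 := ℝ)
      (fun z hz => (hh.hasFDerivAt_of_isOpen hU (hNU (hseg hz))).differentiableAt)
      (fun z hz => ?_) (left_mem_segment ℝ x y) (right_mem_segment ℝ x y)
    have := hM x ⟨hx.1, hx.2.2⟩ z (hseg hz)
    rw [hx0, sub_zero] at this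
    refine this.trans (by gcongr; exact norm_sub_le_of_mem_segment hz)

/-- Where `g` is flat to an order at least the dimension of its source, its image has Hausdorff
dimension less than one. -/
theorem isMeagre_image_flatSet [FiniteDimensional ℝ X] [FiniteDimensional ℝ Q] [Nontrivial Q]
    {U : Set X} (hU : IsOpen U) {g : X → Q} (hg : ContDiffOn ℝ ∞ g U) :
    IsMeagre (g '' (U ∩ flatSet (finrank ℝ X) (fderiv ℝ g))) := by
  refine isMeagre_image_of_locally fun x hx => ?_
  obtain ⟨r, hr, hrU⟩ := Metric.nhds_basis_closedBall.mem_iff.1 (hU.mem_nhds hx.1)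
  refine ⟨_, Metric.closedBall_mem_nhds x hr, ?_⟩
  have : ProperSpace X := FiniteDimensional.proper ℝ X
  have hN := isCompact_closedBall x r
  set N := Metric.closedBall x r
  set d := finrank ℝ X
  obtain ⟨M, hM0, hM⟩ := exists_norm_sub_le_pow_of_flatSet hU hN (convex_closedBall x r) hrU d hg
  set A := N ∩ flatSet d (fderiv ℝ g)
  have hsub : g '' (U ∩ flatSet d (fderiv ℝ g) ∩ N) ⊆ g '' A :=
    image_mono fun y hy => ⟨hy.2, hy.1.2⟩
  refine IsMeagre.mono hsub ?_
  have hAc : IsClosed A := isClosed_inter_flatSet hU hN.isClosed hrU d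
    (hg.fderiv_of_isOpen hU (m := ∞) le_rfl)
  have hAk : IsCompact A := hN.of_isClosed_subset hAc inter_subset_left
  have hgA : IsClosed (g '' A) :=
    (hAk.image_of_continuousOn (hg.continuousOn.mono (inter_subset_left.trans hrU))).isClosed
  refine hgA.isMeagre_of_interior_eq_empty (interior_eq_empty_iff_dense_compl.2 ?_)
  refine dense_compl_of_dimH_lt_finrank ?_
  have hH : HolderOnWith M.toNNReal ((d + 1 : ℕ) : ℝ≥0) g A := by
    intro y hy z hz
    have := hM z hz y hy.1
    rw [edist_dist, edist_dist, dist_eq_norm, dist_eq_norm]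
    refine (ENNReal.ofReal_le_ofReal this).trans ?_
    rw [ENNReal.ofReal_mul hM0, ENNReal.ofReal_pow (norm_nonneg _)]
    rw [NNReal.coe_natCast, ENNReal.rpow_natCast]
    rfl
  refine (hH.dimH_image_le (by positivity)).trans_lt ?_
  have h1 : dimH A ≤ d := (dimH_mono (subset_univ _)).trans (Real.dimH_univ_eq_finrank X).le
  have h2 : (1 : ENNReal) ≤ finrank ℝ Q := by exact_mod_cast Module.finrank_pos (R := ℝ) (M := Q)
  refine lt_of_lt_of_le ?_ h2
  refine (ENNReal.div_le_div_right h1 _).trans_lt ?_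
  rw [ENNReal.div_lt_iff (by simp) (by simp)]
  simp only [one_mul, ENNReal.coe_natCast]
  exact_mod_cast Nat.lt_succ_self d

/-! ### Straightening a function with nonzero derivative -/

/-- A smooth function with nonzero derivative `ℓ` at `x₀` becomes the linear function `ℓ` in
suitable local coordinates; `θ` is the inverse coordinate change. -/
theorem exists_straightening [FiniteDimensional ℝ X] {U : Set X} (hU : IsOpen U) {u : X → ℝ}
    (hu : ContDiffOn ℝ ∞ u U) {x₀ : X} (hx₀ : x₀ ∈ U) (hd : fderiv ℝ u x₀ ≠ 0) :
    ∃ (ℓ : X →L[ℝ] ℝ) (v : X) (V T : Set X) (θ : X → X), ℓ v = 1 ∧ V ∈ 𝓝 x₀ ∧ IsOpen T ∧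
      ContDiffOn ℝ ∞ θ T ∧ (∀ x ∈ V, ∃ p ∈ T, ℓ p = u x ∧ θ p = x) ∧
      ∀ p ∈ T, θ p ∈ U ∧ u (θ p) = ℓ p := by
  have : CompleteSpace X := FiniteDimensional.complete ℝ X
  set ℓ := fderiv ℝ u x₀
  obtain ⟨v, hv⟩ : ∃ v, ℓ v = 1 := by
    obtain ⟨w, hw⟩ : ∃ w, ℓ w ≠ 0 := by
      by_contra! h
      exact hd (ContinuousLinearMap.ext h)
    exact ⟨(ℓ w)⁻¹ • w, by simp [hw]⟩
  let ψ : X → X := fun x => x + (u x - ℓ x) • v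
  have hψ : ContDiffOn ℝ ∞ ψ U := by
    refine contDiffOn_id.add ((hu.sub ?_).smul contDiffOn_const)
    exact ℓ.contDiff.contDiffOn
  have hℓψ : ∀ x, ℓ (ψ x) = u x := fun x => by simp [ψ, hv]
  have hψ' : HasFDerivAt ψ ((ContinuousLinearEquiv.refl ℝ X : X ≃L[ℝ] X) : X →L[ℝ] X) x₀ := by
    have h1 : HasFDerivAt (fun x => u x - ℓ x) (ℓ - ℓ) x₀ :=
      (hu.hasFDerivAt_of_isOpen hU hx₀).sub ℓ.hasFDerivAt
    refine ((hasFDerivAt_id x₀).add (h1.smul_const v)).congr_fderiv ?_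
    ext y
    simp
  let e := (hψ.contDiffAt (hU.mem_nhds hx₀)).toOpenPartialHomeomorph ψ hψ' (by simp)
  have hx₀e : x₀ ∈ e.source :=
    (hψ.contDiffAt (hU.mem_nhds hx₀)).mem_toOpenPartialHomeomorph_source hψ' (by simp)
  -- the inverse of `ψ` is smooth where the derivative of `ψ` is invertible
  let V := e.source ∩ (U ∩ fderiv ℝ ψ ⁻¹' range ContinuousLinearEquiv.toContinuousLinearMap)
  have hVo : IsOpen V := e.open_source.inter
    ((hψ.fderiv_of_isOpen hU (m := ∞) le_rfl).continuousOn.isOpen_inter_preimage hU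
      ContinuousLinearEquiv.isOpen)
  have hVe : V ⊆ e.source := inter_subset_left
  refine ⟨ℓ, v, V, e '' V, e.symm, hv, hVo.mem_nhds ⟨hx₀e, hx₀, ?_⟩,
    e.isOpen_image_of_subset_source hVo hVe, ?_, ?_, ?_⟩
  · exact ⟨_, hψ'.fderiv.symm⟩
  · rintro _ ⟨x, hx, rfl⟩
    obtain ⟨L, hL⟩ := hx.2.2
    refine (e.contDiffAt_symm (f₀' := L) (e.map_source hx.1) ?_ ?_).contDiffWithinAt
    · rw [e.left_inv hx.1, hL]
      exact hψ.hasFDerivAt_of_isOpen hU hx.2.1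
    · rw [e.left_inv hx.1]
      exact hψ.contDiffAt (hU.mem_nhds hx.2.1)
  · exact fun x hx => ⟨e x, mem_image_of_mem _ hx, hℓψ x, e.left_inv hx.1⟩
  · rintro _ ⟨x, hx, rfl⟩
    rw [e.left_inv hx.1]
    exact ⟨hx.2.1, (hℓψ x).symm⟩
end

/-! ### Critical values are meagre -/

section
variable {X F Q : Type u} [NormedAddCommGroup X] [NormedSpace ℝ X]
  [NormedAddCommGroup F] [NormedSpace ℝ F] [NormedAddCommGroup Q] [NormedSpace ℝ Q]

/-- The critical points of `g` in `U`: the points where the derivative is not surjective. -/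
def criticalSet (g : X → Q) (U : Set X) : Set X :=
  {x | x ∈ U ∧ ¬ Function.Surjective (fderiv ℝ g x)}

/-- Critical values are meagre for all smooth maps from spaces of dimension less than `d`; the
hypothesis of the induction that proves `isMeagre_image_criticalSet`. -/
def MeagreCriticalValuesBelow (d : ℕ) : Prop :=
  ∀ (Y P : Type u) [NormedAddCommGroup Y] [NormedSpace ℝ Y] [NormedAddCommGroup P]
    [NormedSpace ℝ P] [FiniteDimensional ℝ Y] [FiniteDimensional ℝ P], finrank ℝ Y < d →
    ∀ (W : Set Y) (g : Y → P), IsOpen W → ContDiffOn ℝ ∞ g W → IsMeagre (g '' criticalSet g W)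

theorem finrank_ker_lt [FiniteDimensional ℝ X] {ℓ : X →L[ℝ] ℝ} {v : X} (hv : ℓ v = 1) :
    finrank ℝ ℓ.ker < finrank ℝ X := by
  refine Submodule.finrank_lt fun h => ?_
  have : v ∈ ℓ.ker := h ▸ Submodule.mem_top
  simp [hv] at this

theorem contDiff_add_coe (ℓ : X →L[ℝ] ℝ) (v : X) :
    ContDiff ℝ ∞ (fun z : ℓ.ker => v + (z : X)) :=
  contDiff_const.add ℓ.ker.subtypeL.contDiff

theorem exists_component_fderiv_ne_zero {U : Set X} (hU : IsOpen U) {g : X → F}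
    (hg : ContDiffOn ℝ ∞ g U) {x₀ : X} (hx₀ : x₀ ∈ U) (hd : fderiv ℝ g x₀ ≠ 0) :
    ∃ (l : F →L[ℝ] ℝ) (w : X), l (fderiv ℝ g x₀ w) = 1 ∧
      ContDiffOn ℝ ∞ (fun x => l (g x)) U ∧ fderiv ℝ (fun x => l (g x)) x₀ ≠ 0 := by
  obtain ⟨w, hw⟩ : ∃ w, fderiv ℝ g x₀ w ≠ 0 := by
    by_contra! h
    exact hd (ContinuousLinearMap.ext h)
  obtain ⟨l, hl⟩ := SeparatingDual.exists_eq_one (R := ℝ) hw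
  refine ⟨l, w, hl, l.contDiff.comp_contDiffOn hg, fun h0 => ?_⟩
  have h1 : HasFDerivAt (fun x => l (g x)) (l ∘L fderiv ℝ g x₀) x₀ :=
    l.hasFDerivAt.comp x₀ (hg.hasFDerivAt_of_isOpen hU hx₀)
  have h2 := congrArg (fun L : X →L[ℝ] ℝ => L w) (h1.fderiv.symm.trans h0)
  simp [hl] at h2

/-- Critical points where the derivative vanishes, on a regular level set of an auxiliary map `h`:
they are critical points of the restriction of `g` to a hypersurface. -/
theorem isMeagre_image_fderiv_eq_zero_of_hypersurface [FiniteDimensional ℝ X]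
    [FiniteDimensional ℝ Q] [Nontrivial Q]
    (ih : MeagreCriticalValuesBelow.{u} (finrank ℝ X)) {U : Set X} (hU : IsOpen U)
    {g : X → Q} (hg : ContDiffOn ℝ ∞ g U) {h : X → F} (hh : ContDiffOn ℝ ∞ h U) :
    IsMeagre (g '' {x | x ∈ U ∧ fderiv ℝ g x = 0 ∧ h x = 0 ∧ fderiv ℝ h x ≠ 0}) := by
  refine isMeagre_image_of_locally fun x₀ hx₀ => ?_
  obtain ⟨l, w, hlw, hu, hud⟩ := exists_component_fderiv_ne_zero hU hh hx₀.1 hx₀.2.2.2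
  obtain ⟨ℓ, v, V, T, θ, hv, hV, hT, hθ, h1, h2⟩ := exists_straightening hU hu hx₀.1 hud
  refine ⟨V, hV, ?_⟩
  set W : Set ℓ.ker := (fun z : ℓ.ker => (0 : X) + (z : X)) ⁻¹' T
  have hW : IsOpen W := hT.preimage (contDiff_add_coe ℓ 0).continuous
  have hθW : ContDiffOn ℝ ∞ (fun z : ℓ.ker => θ (0 + (z : X))) W :=
    hθ.comp (contDiff_add_coe ℓ 0).contDiffOn fun z hz => hz
  have hgW : ContDiffOn ℝ ∞ (fun z : ℓ.ker => g (θ (0 + (z : X)))) W :=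
    hg.comp hθW fun z hz => (h2 _ hz).1
  refine (ih ℓ.ker Q (finrank_ker_lt hv) W _ hW hgW).mono ?_
  rintro _ ⟨x, ⟨⟨hxU, hgx, hhx, -⟩, hxV⟩, rfl⟩
  obtain ⟨p, hpT, hpu, rfl⟩ := h1 x hxV
  have hp : p ∈ ℓ.ker := by
    rw [LinearMap.mem_ker]
    exact hpu.trans (by simp [hhx])
  have hpW : (⟨p, hp⟩ : ℓ.ker) ∈ W := by simpa [W] using hpT
  refine ⟨⟨p, hp⟩, ⟨hpW, ?_⟩, by simp⟩
  have hd := (hg.hasFDerivAt_of_isOpen hU hxU)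
  have hd' := HasFDerivAt.comp (g := g) (⟨p, hp⟩ : ℓ.ker) (by simpa using hd)
    (hθW.hasFDerivAt_of_isOpen hW hpW)
  have hd0 : fderiv ℝ (fun z : ℓ.ker => g (θ (0 + (z : X)))) ⟨p, hp⟩ = 0 := by
    refine hd'.fderiv.trans ?_
    rw [hgx, ContinuousLinearMap.zero_comp]
  rw [hd0]
  intro hs
  obtain ⟨q, hq⟩ := exists_ne (0 : Q)
  obtain ⟨z, hz⟩ := hs q
  exact hq (by simpa using hz.symm)

/-- Split by the order `0 < i < k` of the first derivative of `h` that does not vanish, the set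
consists of pieces lying on regular level sets of the derivatives of `h` of order `i - 1`. -/
theorem isMeagre_image_fderiv_eq_zero_diff_flatSet [FiniteDimensional ℝ X]
    [FiniteDimensional ℝ Q] [Nontrivial Q]
    (ih : MeagreCriticalValuesBelow.{u} (finrank ℝ X)) {U : Set X} (hU : IsOpen U)
    {g : X → Q} (hg : ContDiffOn ℝ ∞ g U) (k : ℕ) {F : Type u} [NormedAddCommGroup F]
    [NormedSpace ℝ F] {h : X → F} (hh : ContDiffOn ℝ ∞ h U) :
    IsMeagre (g '' {x | x ∈ U ∧ fderiv ℝ g x = 0 ∧ h x = 0 ∧ x ∉ flatSet k h}) := by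
  induction k generalizing F with
  | zero =>
    convert IsMeagre.empty using 1
    rw [image_eq_empty]
    exact eq_empty_of_forall_notMem fun x hx => hx.2.2.2 (mem_univ x)
  | succ k ihk =>
    refine ((isMeagre_image_fderiv_eq_zero_of_hypersurface ih hU hg hh).union
      (ihk (hh.fderiv_of_isOpen hU (m := ∞) le_rfl))).mono ?_
    rw [← image_union]
    refine image_mono fun x hx => ?_
    obtain ⟨hxU, hgx, hhx, hx⟩ := hx
    by_cases hd : fderiv ℝ h x = 0
    · exact Or.inr ⟨hxU, hgx, hd, fun hf => hx ⟨hhx, hf⟩⟩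
    · exact Or.inl ⟨hxU, hgx, hhx, hd⟩

/-- `L` is surjective if its range contains a vector with `l = 1` and, through `J`, all of the
kernel of `l`. The latter is phrased with a projection `π` to this kernel because that is how the
slices of a map are differentiated. -/
theorem surjective_of_surjective_ker {Y : Type u} [NormedAddCommGroup Y] [NormedSpace ℝ Y]
    {L : X →L[ℝ] Q} {l : Q →L[ℝ] ℝ} {w : X} (hw : l (L w) = 1) {J : Y →L[ℝ] X}
    (hJ : ∀ y, l (L (J y)) = 0) {π : Q →L[ℝ] l.ker} (hπ : ∀ q : l.ker, π q = q)
    (hs : Function.Surjective (π ∘L L ∘L J)) : Function.Surjective L := by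
  intro q
  have hq : q - l q • L w ∈ l.ker := by
    rw [LinearMap.mem_ker]
    simp [hw]
  obtain ⟨y, hy⟩ := hs ⟨_, hq⟩
  have h1 := hπ ⟨L (J y), LinearMap.mem_ker.2 (hJ y)⟩
  have h2 : L (J y) = q - l q • L w := congrArg Subtype.val (h1.symm.trans hy)
  exact ⟨J y + l q • w, by simp [h2]⟩

/-- Critical points where the derivative is not zero: in suitable coordinates one component of `g`
is a coordinate function, and the critical points on each of its level sets are critical points of
a map between spaces of lower dimension. A compact set with slices without interior points has no
interior points. -/
theorem isMeagre_image_criticalSet_fderiv_ne_zero [FiniteDimensional ℝ X]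
    [FiniteDimensional ℝ Q]
    (ih : MeagreCriticalValuesBelow.{u} (finrank ℝ X)) {U : Set X} (hU : IsOpen U)
    {g : X → Q} (hg : ContDiffOn ℝ ∞ g U) :
    IsMeagre (g '' {x | x ∈ criticalSet g U ∧ fderiv ℝ g x ≠ 0}) := by
  have : ProperSpace X := FiniteDimensional.proper ℝ X
  refine isMeagre_image_of_locally fun x₀ hx₀ => ?_
  obtain ⟨l, w, hlw, hu, hud⟩ := exists_component_fderiv_ne_zero hU hg hx₀.1.1 hx₀.2
  set e := fderiv ℝ g x₀ w
  obtain ⟨ℓ, v, V, T, θ, hv, hV, hT, hθ, h1, h2⟩ := exists_straightening hU hu hx₀.1.1 hud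
  obtain ⟨r, hr, hrV⟩ := Metric.nhds_basis_closedBall.mem_iff.1
    (inter_mem hV (hU.mem_nhds hx₀.1.1))
  refine ⟨_, Metric.closedBall_mem_nhds x₀ hr, ?_⟩
  set N := Metric.closedBall x₀ r
  have hNU : N ⊆ U := hrV.trans inter_subset_right
  set A := N ∩ {x | ¬ Function.Surjective (fderiv ℝ g x)}
  have hA : IsCompact A := by
    refine (isCompact_closedBall x₀ r).of_isClosed_subset ?_ inter_subset_left
    exact ((hg.fderiv_of_isOpen hU (m := ∞) le_rfl).continuousOn.mono
      hNU).preimage_isClosed_of_isClosed Metric.isClosed_closedBall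
        isOpen_setOf_surjective.isClosed_compl
  refine IsMeagre.mono (image_mono (t := A) fun x hx => ⟨hx.2, hx.1.1.2⟩) ?_
  have hgA : IsClosed (g '' A) :=
    (hA.image_of_continuousOn (hg.continuousOn.mono (inter_subset_left.trans hNU))).isClosed
  refine hgA.isMeagre_of_interior_eq_empty (eq_empty_of_forall_notMem fun q₀ hq₀ => ?_)
  -- the projection to the kernel of `l` along `e`, and the slice through `q₀`
  let π : Q →L[ℝ] l.ker :=
    (ContinuousLinearMap.id ℝ Q - l.smulRight e).codRestrict l.ker fun q => by
      rw [LinearMap.mem_ker]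
      simp [hlw]
  have hπ : ∀ q : l.ker, π q = q := by
    rintro ⟨q, hq⟩
    have : l q = 0 := hq
    ext
    simp [π, this]
  have hπv : ∀ q : Q, ((π q : l.ker) : Q) = q - l q • e := fun q => rfl
  set t := l q₀
  set W : Set ℓ.ker := (fun z : ℓ.ker => t • v + (z : X)) ⁻¹' T
  have hW : IsOpen W := hT.preimage (contDiff_add_coe ℓ _).continuous
  have hθW : ContDiffOn ℝ ∞ (fun z : ℓ.ker => θ (t • v + (z : X))) W :=
    hθ.comp (contDiff_add_coe ℓ _).contDiffOn fun z hz => hz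
  have hgW : ContDiffOn ℝ ∞ (fun z : ℓ.ker => π (g (θ (t • v + (z : X))))) W :=
    π.contDiff.comp_contDiffOn (hg.comp hθW fun z hz => (h2 _ hz).1)
  have hm := ih ℓ.ker l.ker (finrank_ker_lt hv) W _ hW hgW
  have : CompleteSpace l.ker := FiniteDimensional.complete ℝ _
  have hO : IsOpen ((fun p : l.ker => t • e + (p : Q)) ⁻¹' interior (g '' A)) :=
    isOpen_interior.preimage (contDiff_add_coe l _).continuous
  have hmem : π q₀ ∈ (fun p : l.ker => t • e + (p : Q)) ⁻¹' interior (g '' A) := by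
    rw [mem_preimage, hπv, add_sub_cancel]
    exact hq₀
  refine (eq_empty_iff_forall_notMem.1 hm.interior_eq_empty) (π q₀)
    (mem_interior.2 ⟨_, ?_, hO, hmem⟩)
  intro p hp
  obtain ⟨x, ⟨hxN, hxs⟩, hgx⟩ := interior_subset (mem_preimage.1 hp)
  obtain ⟨y, hyT, hyu, rfl⟩ := h1 x (hrV hxN).1
  have hlp : l (p : Q) = 0 := p.2
  have hly : l (g (θ y)) = t := by
    rw [hgx]
    simp [hlp, hlw]
  have hz : y - t • v ∈ ℓ.ker := by
    rw [LinearMap.mem_ker]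
    simp [hv, hyu, hly]
  have hzy : t • v + (y - t • v) = y := by abel
  have hzW : (⟨y - t • v, hz⟩ : ℓ.ker) ∈ W := by
    change t • v + (y - t • v) ∈ T
    rwa [hzy]
  refine ⟨⟨y - t • v, hz⟩, ⟨hzW, fun hs => hxs ?_⟩, ?_⟩
  swap
  · simp only [hzy, hgx]
    ext
    rw [hπv]
    simp [hlw, hlp]
  have hdg := hg.hasFDerivAt_of_isOpen hU (hNU hxN)
  have hdθ := hθ.hasFDerivAt_of_isOpen hT hyT
  have hdi : HasFDerivAt (fun z : ℓ.ker => t • v + (z : X)) ℓ.ker.subtypeL ⟨y - t • v, hz⟩ :=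
    ℓ.ker.subtypeL.hasFDerivAt.const_add _
  -- `l ∘ g ∘ θ` is the linear map `ℓ`
  have hlin : l ∘L fderiv ℝ g (θ y) ∘L fderiv ℝ θ y = ℓ := by
    refine (l.hasFDerivAt.comp y (hdg.comp y hdθ)).unique
      (ℓ.hasFDerivAt.congr_of_eventuallyEq ?_)
    filter_upwards [hT.mem_nhds hyT] with p hp using (h2 p hp).2
  have hlin' : ∀ z, l (fderiv ℝ g (θ y) (fderiv ℝ θ y z)) = ℓ z := fun z =>
    congrArg (fun L : X →L[ℝ] ℝ => L z) hlin
  refine surjective_of_surjective_ker (w := fderiv ℝ θ y v)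
    (J := fderiv ℝ θ y ∘L ℓ.ker.subtypeL) (π := π) (l := l) ?_ ?_ hπ ?_
  · rw [hlin', hv]
  · intro z
    exact (hlin' z).trans z.2
  · have hd : HasFDerivAt (fun z : ℓ.ker => π (g (θ (t • v + (z : X)))))
        (π ∘L fderiv ℝ g (θ y) ∘L fderiv ℝ θ y ∘L ℓ.ker.subtypeL) ⟨y - t • v, hz⟩ := by
      rw [← hzy] at hdg hdθ
      have := π.hasFDerivAt.comp (⟨y - t • v, hz⟩ : ℓ.ker)
        (hdg.comp (⟨y - t • v, hz⟩ : ℓ.ker) (hdθ.comp (⟨y - t • v, hz⟩ : ℓ.ker) hdi))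
      rw [hzy] at this
      exact this
    rwa [hd.fderiv] at hs

/-- **Sard's theorem**, in the category form due to A. B. Brown: the critical values of a smooth
map between finite dimensional spaces form a meagre set. -/
theorem isMeagre_image_criticalSet [FiniteDimensional ℝ X] [FiniteDimensional ℝ Q]
    {U : Set X} (hU : IsOpen U) {g : X → Q} (hg : ContDiffOn ℝ ∞ g U) :
    IsMeagre (g '' criticalSet g U) := by
  suffices H : ∀ d, MeagreCriticalValuesBelow.{u} d from
    H _ X Q (Nat.lt_succ_self _) U g hU hg
  intro d
  induction d with
  | zero => exact fun Y P _ _ _ _ _ _ h => absurd h (Nat.not_lt_zero _)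
  | succ d ihd =>
    intro Y P _ _ _ _ _ _ hd W g hW hg
    have ih : MeagreCriticalValuesBelow.{u} (finrank ℝ Y) := fun Y' P' _ _ _ _ _ _ h =>
      ihd Y' P' (by omega)
    rcases subsingleton_or_nontrivial P with hP | hP
    · convert IsMeagre.empty using 1
      rw [image_eq_empty]
      exact eq_empty_of_forall_notMem fun x hx => hx.2 fun q => ⟨0, Subsingleton.elim _ _⟩
    refine (((isMeagre_image_criticalSet_fderiv_ne_zero ih hW hg).union
      (isMeagre_image_fderiv_eq_zero_diff_flatSet ih hW hg (finrank ℝ Y)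
        (hg.fderiv_of_isOpen hW (m := ∞) le_rfl))).union (isMeagre_image_flatSet hW hg)).mono ?_
    rw [← image_union, ← image_union]
    refine image_mono fun x hx => ?_
    by_cases h0 : fderiv ℝ g x = 0
    · by_cases hf : x ∈ flatSet (finrank ℝ Y) (fderiv ℝ g)
      · exact Or.inr ⟨hx.1, hf⟩
      · exact Or.inl (Or.inr ⟨hx.1, h0, h0, hf⟩)
    · exact Or.inl (Or.inl ⟨hx, h0⟩)
end

/-! ### The smooth weak topology -/

namespace SmoothMap
variable {m n : ℕ}

theorem withSeminorms_weakSeminorms (m n : ℕ) : WithSeminorms (weakSeminorms m n) := ⟨rfl⟩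

theorem multiDeriv_zero : multiDeriv (m := m) (n := n) 0 = 1 := by
  simp [multiDeriv]

theorem prod_map_pow_single {ι M : Type*} [DecidableEq ι] [Monoid M] (a : ι → M) (i : ι)
    {l : List ι} (hl : l.Nodup) :
    (l.map fun j => a j ^ (Pi.single i 1 : ι → ℕ) j).prod = if i ∈ l then a i else 1 := by
  induction l with
  | nil => simp
  | cons j l ih =>
    rw [List.nodup_cons] at hl
    rw [List.map_cons, List.prod_cons, ih hl.2]
    rcases eq_or_ne i j with rfl | h
    · simp [hl.1]
    · simp [h, h.symm]

theorem multiDeriv_single (i : Fin m) :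
    multiDeriv (n := n) (Pi.single i 1 : Fin m → ℕ) = partialDeriv i := by
  rw [multiDeriv, prod_map_pow_single _ i (List.nodup_finRange m)]
  simp

theorem norm_multiDeriv_sub_le (L : TopologicalSpace.Compacts (EuclideanSpace ℝ (Fin m)))
    (α : Fin m → ℕ) (f g : SmoothMap m n) {x : EuclideanSpace ℝ (Fin m)} (hx : x ∈ L) :
    ‖multiDeriv α f x - multiDeriv α g x‖ ≤ weakSeminorms m n (L, α) (f - g) := by
  have h : multiDeriv α f x - multiDeriv α g x = multiDeriv α (f - g) x := by
    rw [map_sub]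
    rfl
  rw [h]
  exact le_ciSup (bddAbove_norm L (multiDeriv α (f - g))) ⟨x, hx⟩

theorem continuous_multiDeriv_apply (α : Fin m → ℕ) :
    Continuous fun p : SmoothMap m n × EuclideanSpace ℝ (Fin m) => multiDeriv α p.1 p.2 := by
  have := (withSeminorms_weakSeminorms m n).topologicalAddGroup
  rw [continuous_iff_continuousAt]
  rintro ⟨f₀, x₀⟩
  rw [ContinuousAt, tendsto_iff_norm_sub_tendsto_zero]
  let L : TopologicalSpace.Compacts (EuclideanSpace ℝ (Fin m)) :=
    ⟨Metric.closedBall x₀ 1, isCompact_closedBall x₀ 1⟩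
  have h1 : Continuous fun p : SmoothMap m n × EuclideanSpace ℝ (Fin m) =>
      weakSeminorms m n (L, α) (p.1 - f₀) + ‖multiDeriv α f₀ p.2 - multiDeriv α f₀ x₀‖ := by
    have hs := (withSeminorms_weakSeminorms m n).continuous_seminorm (L, α)
    have hc : Continuous (multiDeriv α f₀) := (multiDeriv α f₀).contMDiff.continuous
    exact (hs.comp (continuous_fst.sub continuous_const)).add
      ((hc.comp continuous_snd).sub continuous_const).norm
  have h2 := h1.tendsto (f₀, x₀)
  simp only [sub_self, map_zero, norm_zero, add_zero] at h2
  refine tendsto_of_tendsto_of_tendsto_of_le_of_le' tendsto_const_nhds h2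
    (Eventually.of_forall fun _ => norm_nonneg _) ?_
  have hx : ∀ᶠ p : SmoothMap m n × EuclideanSpace ℝ (Fin m) in 𝓝 (f₀, x₀),
      p.2 ∈ Metric.closedBall x₀ 1 :=
    continuousAt_snd.eventually (Metric.closedBall_mem_nhds x₀ one_pos)
  filter_upwards [hx] with p hp
  exact (norm_sub_le_norm_sub_add_norm_sub _ (multiDeriv α f₀ p.2) _).trans
    (add_le_add_left (norm_multiDeriv_sub_le L α p.1 f₀ hp) _)

theorem fderiv_eq_sum (f : SmoothMap m n) (x : EuclideanSpace ℝ (Fin m)) :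
    fderiv ℝ f x = ∑ i, (EuclideanSpace.proj i : EuclideanSpace ℝ (Fin m) →L[ℝ] ℝ).smulRight
      (partialDeriv i f x) := by
  ext1 v
  conv_lhs => rw [← (EuclideanSpace.basisFun (Fin m) ℝ).sum_repr v]
  simp only [map_sum, map_smul, sum_apply]
  refine Finset.sum_congr rfl fun i _ => ?_
  simp only [EuclideanSpace.basisFun_repr, EuclideanSpace.basisFun_apply,
    ContinuousLinearMap.smulRight_apply]
  rfl

/-- The topology is fine enough to make the evaluation of 1-jets continuous. -/
theorem continuous_jet : Continuous fun p : SmoothMap m n × EuclideanSpace ℝ (Fin m) =>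
    (p.1 p.2, fderiv ℝ p.1 p.2) := by
  have h0 := continuous_multiDeriv_apply (m := m) (n := n) 0
  rw [multiDeriv_zero] at h0
  refine h0.prodMk ?_
  simp only [fderiv_eq_sum]
  refine continuous_finsetSum _ fun i _ => ?_
  have hi := continuous_multiDeriv_apply (m := m) (n := n) (Pi.single i 1)
  rw [multiDeriv_single] at hi
  exact (ContinuousLinearMap.smulRightL ℝ _ _
    (EuclideanSpace.proj i : EuclideanSpace ℝ (Fin m) →L[ℝ] ℝ)).continuous.comp hi

theorem isOpen_setOf_forall_jet_mem {K : Set (EuclideanSpace ℝ (Fin m))} (hK : IsCompact K)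
    {O : Set (EuclideanSpace ℝ (Fin n) × (EuclideanSpace ℝ (Fin m) →L[ℝ] EuclideanSpace ℝ (Fin n)))}
    (hO : IsOpen O) : IsOpen {f : SmoothMap m n | ∀ x ∈ K, (f x, fderiv ℝ f x) ∈ O} := by
  rw [isOpen_iff_eventually]
  intro f hf
  exact hK.eventually_forall_of_forall_eventually fun x hx =>
    continuous_jet.continuousAt.eventually (hO.mem_nhds (hf x hx))

end SmoothMap

/-! ### Tangent spaces and transversality in a chart -/

section
variable {n k : ℕ} {S : Set (EuclideanSpace ℝ (Fin n))}
  {φ : OpenPartialHomeomorph (EuclideanSpace ℝ (Fin n)) (EuclideanSpace ℝ (Fin n))}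
  {W : Submodule ℝ (EuclideanSpace ℝ (Fin n))}

theorem symm_mem_of_chart (hφS : φ '' (S ∩ φ.source) = (W : Set _) ∩ φ.target)
    {w : EuclideanSpace ℝ (Fin n)} (hw : w ∈ W) (hwt : w ∈ φ.target) : φ.symm w ∈ S := by
  obtain ⟨y, hy, rfl⟩ := hφS.symm.subset ⟨hw, hwt⟩
  rw [φ.left_inv hy.2]
  exact hy.1

/-- The inverse chart maps `W` into the tangent space. -/
theorem fderiv_symm_mem_tangentSpaceOf (hs : ContDiffOn ℝ ∞ φ.symm φ.target)
    (hφS : φ '' (S ∩ φ.source) = (W : Set _) ∩ φ.target)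
    {w : EuclideanSpace ℝ (Fin n)} (hw : w ∈ W) (hwt : w ∈ φ.target)
    {v : EuclideanSpace ℝ (Fin n)} (hv : v ∈ W) :
    fderiv ℝ φ.symm w v ∈ tangentSpaceOf S (φ.symm w) := by
  have hl : ContDiff ℝ ∞ fun t : ℝ => w + t • v := by fun_prop
  have ho : IsOpen ((fun t : ℝ => w + t • v) ⁻¹' φ.target) :=
    φ.open_target.preimage hl.continuous
  obtain ⟨ε, hε, hb⟩ := Metric.isOpen_iff.1 ho 0 (by simpa using hwt)
  rw [Real.ball_eq_Ioo, zero_sub, zero_add] at hb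
  refine Submodule.subset_span ⟨fun t => φ.symm (w + t • v), ε, hε,
    hs.comp hl.contDiffOn hb, fun t ht => ?_, by simp, ?_⟩
  · exact symm_mem_of_chart hφS (W.add_mem hw (W.smul_mem t hv)) (hb ht)
  · have h1 : HasDerivAt (fun t : ℝ => w + t • v) v 0 := by
      simpa using ((hasDerivAt_id (0 : ℝ)).smul_const v).const_add w
    refine HasFDerivAt.comp_hasDerivAt (0 : ℝ) (f := fun t : ℝ => w + t • v) ?_ h1
    simpa using hs.hasFDerivAt_of_isOpen φ.open_target hwt

/-- A chart maps the tangent space into `W`. -/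
theorem fderiv_mem_of_mem_tangentSpaceOf (hc : ContDiffOn ℝ ∞ φ φ.source)
    (hφS : φ '' (S ∩ φ.source) = (W : Set _) ∩ φ.target)
    {y : EuclideanSpace ℝ (Fin n)} (hy : y ∈ φ.source)
    {v : EuclideanSpace ℝ (Fin n)} (hv : v ∈ tangentSpaceOf S y) : fderiv ℝ φ y v ∈ W := by
  suffices h : tangentSpaceOf S y ≤ W.comap (fderiv ℝ φ y).toLinearMap from h hv
  refine Submodule.span_le.2 ?_
  rintro v ⟨γ, ε, hε, -, hγS, rfl, hγ⟩
  have hd : HasDerivAt (fun t => φ (γ t)) (fderiv ℝ φ (γ 0) v) 0 :=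
    (hc.hasFDerivAt_of_isOpen φ.open_source hy).comp_hasDerivAt (0 : ℝ) hγ
  have hcl : IsClosed (W : Set (EuclideanSpace ℝ (Fin n))) := W.closed_of_finiteDimensional
  refine hcl.mem_of_tendsto hd.tendsto_slope_zero ?_
  have h1 : ∀ᶠ t in 𝓝 (0 : ℝ), t ∈ Ioo (-ε) ε := Ioo_mem_nhds (by linarith) hε
  have h2 : ∀ᶠ t in 𝓝 (0 : ℝ), γ t ∈ φ.source :=
    hγ.continuousAt.eventually (φ.open_source.mem_nhds hy)
  have hW : ∀ t ∈ Ioo (-ε) ε, γ t ∈ φ.source → φ (γ t) ∈ W := fun t ht hts =>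
    (hφS.subset (mem_image_of_mem φ ⟨hγS t ht, hts⟩)).1
  refine nhdsWithin_le_nhds ?_
  filter_upwards [h1, h2] with t ht hts
  rw [zero_add]
  exact W.smul_mem _ (W.sub_mem (hW t ht hts) (hW 0 (by constructor <;> linarith) hy))

theorem fderiv_symm_comp_fderiv (hc : ContDiffOn ℝ ∞ φ φ.source)
    (hs : ContDiffOn ℝ ∞ φ.symm φ.target)
    {y : EuclideanSpace ℝ (Fin n)} (hy : y ∈ φ.source) (v : EuclideanSpace ℝ (Fin n)) :
    fderiv ℝ φ.symm (φ y) (fderiv ℝ φ y v) = v ∧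
      fderiv ℝ φ y (fderiv ℝ φ.symm (φ y) v) = v := by
  have h1 := hc.hasFDerivAt_of_isOpen φ.open_source hy
  have h2 := hs.hasFDerivAt_of_isOpen φ.open_target (φ.map_source hy)
  constructor
  · have h := (h2.comp y h1).unique ((hasFDerivAt_id y).congr_of_eventuallyEq
      (φ.eventually_left_inverse hy))
    exact congrArg (fun L : EuclideanSpace ℝ (Fin n) →L[ℝ] EuclideanSpace ℝ (Fin n) => L v) h
  · have h1' : HasFDerivAt φ (fderiv ℝ φ y) (φ.symm (φ y)) := by rwa [φ.left_inv hy]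
    have h := (h1'.comp (φ y) h2).unique ((hasFDerivAt_id (φ y)).congr_of_eventuallyEq
      (φ.eventually_right_inverse (φ.map_source hy)))
    exact congrArg (fun L : EuclideanSpace ℝ (Fin n) →L[ℝ] EuclideanSpace ℝ (Fin n) => L v) h

theorem mem_tangentSpaceOf_iff (hc : ContDiffOn ℝ ∞ φ φ.source)
    (hs : ContDiffOn ℝ ∞ φ.symm φ.target)
    (hφS : φ '' (S ∩ φ.source) = (W : Set _) ∩ φ.target)
    {y : EuclideanSpace ℝ (Fin n)} (hyS : y ∈ S) (hy : y ∈ φ.source)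
    (v : EuclideanSpace ℝ (Fin n)) : v ∈ tangentSpaceOf S y ↔ fderiv ℝ φ y v ∈ W := by
  refine ⟨fderiv_mem_of_mem_tangentSpaceOf hc hφS hy, fun hv => ?_⟩
  have hw : φ y ∈ W := (hφS.subset (mem_image_of_mem φ ⟨hyS, hy⟩)).1
  have h := fderiv_symm_mem_tangentSpaceOf hs hφS hw (φ.map_source hy) hv
  rwa [(fderiv_symm_comp_fderiv hc hs hy v).1, φ.left_inv hy] at h

/-- The 1-jets with nonzero value that are transverse to `S`. -/
def transverseJets (m : ℕ) (S : Set (EuclideanSpace ℝ (Fin n))) :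
    Set (EuclideanSpace ℝ (Fin n) × (EuclideanSpace ℝ (Fin m) →L[ℝ] EuclideanSpace ℝ (Fin n))) :=
  {p | p.1 ≠ 0 ∧ (p.1 ∈ S → LinearMap.range p.2.toLinearMap ⊔ tangentSpaceOf S p.1 = ⊤)}

/-- In a chart, transversality means that the derivative is surjective modulo `W`. -/
theorem sup_tangentSpaceOf_eq_top_iff (hc : ContDiffOn ℝ ∞ φ φ.source)
    (hs : ContDiffOn ℝ ∞ φ.symm φ.target)
    (hφS : φ '' (S ∩ φ.source) = (W : Set _) ∩ φ.target)
    {y : EuclideanSpace ℝ (Fin n)} (hyS : y ∈ S) (hy : y ∈ φ.source) {m : ℕ}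
    (A : EuclideanSpace ℝ (Fin m) →L[ℝ] EuclideanSpace ℝ (Fin n)) :
    LinearMap.range A.toLinearMap ⊔ tangentSpaceOf S y = ⊤ ↔
      Function.Surjective (Wᗮ.orthogonalProjectionOnto ∘L fderiv ℝ φ y ∘L A) := by
  have hker : ∀ v, Wᗮ.orthogonalProjectionOnto v = 0 ↔ v ∈ W := fun v => by
    rw [Submodule.orthogonalProjectionOnto_eq_zero_iff, Submodule.orthogonal_orthogonal]
  constructor
  · intro h q
    have hv : fderiv ℝ φ.symm (φ y) q ∈ LinearMap.range A.toLinearMap ⊔ tangentSpaceOf S y :=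
      h ▸ Submodule.mem_top
    obtain ⟨_, ⟨x, rfl⟩, t, ht, hxt⟩ := Submodule.mem_sup.1 hv
    refine ⟨x, ?_⟩
    have h1 := congrArg (fderiv ℝ φ y) hxt
    rw [map_add, (fderiv_symm_comp_fderiv hc hs hy _).2] at h1
    have h2 := congrArg Wᗮ.orthogonalProjectionOnto h1
    rw [map_add, (hker _).2 (fderiv_mem_of_mem_tangentSpaceOf hc hφS hy ht), add_zero] at h2
    simpa using h2
  · intro h
    rw [Submodule.eq_top_iff']
    intro v
    obtain ⟨x, hx⟩ := h (Wᗮ.orthogonalProjectionOnto (fderiv ℝ φ y v))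
    refine Submodule.mem_sup.2 ⟨A x, ⟨x, rfl⟩, v - A x, ?_, add_sub_cancel _ _⟩
    rw [mem_tangentSpaceOf_iff hc hs hφS hyS hy, ← hker, map_sub, map_sub, sub_eq_zero]
    exact hx.symm

/-- At a point outside `S` the hypothesis on the closure of `S` is needed: such a point, if nonzero,
has a neighbourhood disjoint from `S`. -/
theorem isOpen_transverseJets (m : ℕ) (hS : IsSubmanifold k S) (hcl : closure S ⊆ S ∪ {0}) :
    IsOpen (transverseJets m S) := by
  rw [isOpen_iff_mem_nhds]
  rintro ⟨y, A⟩ ⟨hy0, hyA⟩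
  have h0 : ∀ᶠ p in 𝓝 (y, A), p.1 ≠ 0 := continuousAt_fst.eventually_ne hy0
  by_cases hyS : y ∈ S
  · obtain ⟨φ, W, hy, hc, hs, -, hφS⟩ := hS y hyS
    have hsur := (sup_tangentSpaceOf_eq_top_iff hc hs hφS hyS hy A).1 (hyA hyS)
    have hsrc : ∀ᶠ p in 𝓝 (y, A), p.1 ∈ φ.source :=
      continuousAt_fst.eventually (φ.open_source.mem_nhds hy)
    have hcont : ContinuousAt (fun p : EuclideanSpace ℝ (Fin n) ×
        (EuclideanSpace ℝ (Fin m) →L[ℝ] EuclideanSpace ℝ (Fin n)) =>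
        Wᗮ.orthogonalProjectionOnto ∘L fderiv ℝ φ p.1 ∘L p.2) (y, A) := by
      have h1 : ContinuousAt (fderiv ℝ φ) y :=
        (hc.fderiv_of_isOpen φ.open_source (m := ∞) le_rfl).continuousOn.continuousAt
          (φ.open_source.mem_nhds hy)
      exact continuousAt_const.clm_comp ((ContinuousAt.comp (x := (y, A)) (g := fderiv ℝ φ)
        h1 continuousAt_fst).clm_comp continuousAt_snd)
    filter_upwards [h0, hsrc, hcont.eventually (isOpen_setOf_surjective.mem_nhds hsur)]
      with p hp hps hpsur
    exact ⟨hp, fun hpS => (sup_tangentSpaceOf_eq_top_iff hc hs hφS hpS hps p.2).2 hpsur⟩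
  · have hyc : y ∈ (closure S)ᶜ := fun h => (hcl h).elim hyS hy0
    have h1 : ∀ᶠ p in 𝓝 (y, A), p.1 ∈ (closure S)ᶜ :=
      continuousAt_fst.eventually (isClosed_closure.isOpen_compl.mem_nhds hyc)
    filter_upwards [h0, h1] with p hp hpc
    exact ⟨hp, fun hpS => absurd (subset_closure hpS) hpc⟩
end

/-! ### Perturbations that are not transverse -/

section
variable {m n k : ℕ} {S : Set (EuclideanSpace ℝ (Fin n))}
  {f : EuclideanSpace ℝ (Fin m) → EuclideanSpace ℝ (Fin n)}
  {M : EuclideanSpace ℝ (Fin m) → EuclideanSpace ℝ (Fin n) →L[ℝ] EuclideanSpace ℝ (Fin n)}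
  {V : Set (EuclideanSpace ℝ (Fin m))}

theorem contDiffOn_inverse_apply {Y : Type*} [NormedAddCommGroup Y] [NormedSpace ℝ Y]
    (hM : ContDiff ℝ ∞ M) (hMV : ∀ x ∈ V, (M x).IsInvertible) {Ω : Set Y}
    {a : Y → EuclideanSpace ℝ (Fin m)} {b : Y → EuclideanSpace ℝ (Fin n)}
    (ha : ContDiffOn ℝ ∞ a Ω) (haV : MapsTo a Ω V) (hb : ContDiffOn ℝ ∞ b Ω) :
    ContDiffOn ℝ ∞ (fun p => (M (a p)).inverse (b p)) Ω := by
  refine ContDiffOn.clm_apply (fun p hp => ?_) hb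
  exact (hMV _ (haV hp)).contDiffAt_map_inverse.comp_contDiffWithinAt p
    (hM.contDiffAt.comp_contDiffWithinAt p (ha p hp))

theorem isMeagre_perturbations_with_zero (hmn : m < n) (hf : ContDiff ℝ ∞ f)
    (hM : ContDiff ℝ ∞ M) (hV : IsOpen V) (hMV : ∀ x ∈ V, (M x).IsInvertible) :
    IsMeagre {c | ∃ x ∈ V, f x + M x c = 0} := by
  have hG : ContDiffOn ℝ ∞ (fun x => (M x).inverse (-f x)) V :=
    contDiffOn_inverse_apply hM hMV contDiffOn_id (mapsTo_id V) hf.neg.contDiffOn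
  refine (isMeagre_image_criticalSet hV hG).mono ?_
  rintro c ⟨x, hx, hxc⟩
  refine ⟨x, ⟨hx, fun hs => ?_⟩, ?_⟩
  · have h := LinearMap.finrank_le_finrank_of_surjective
      (f := (fderiv ℝ (fun x => (M x).inverse (-f x)) x).toLinearMap) hs
    simp only [finrank_euclideanSpace, Fintype.card_fin] at h
    omega
  · change (M x).inverse (-f x) = c
    rw [neg_eq_of_add_eq_zero_right hxc, ← ContinuousLinearMap.comp_apply,
      (hMV x hx).inverse_comp_self]
    rfl

/-- If `S` is parametrized by `σ = φ⁻¹` on `W`, then `f + M c` hits `S` at `σ w` over `x` exactly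
for `c = (M x)⁻¹ (σ w - f x)`, and it does so transversely if this map of `(x, w)` is a submersion
there. -/
theorem isMeagre_perturbations_not_transverse_in_chart (hf : ContDiff ℝ ∞ f)
    (hM : ContDiff ℝ ∞ M) (hV : IsOpen V) (hMV : ∀ x ∈ V, (M x).IsInvertible)
    {φ : OpenPartialHomeomorph (EuclideanSpace ℝ (Fin n)) (EuclideanSpace ℝ (Fin n))}
    {W : Submodule ℝ (EuclideanSpace ℝ (Fin n))} (hs : ContDiffOn ℝ ∞ φ.symm φ.target)
    (hφS : φ '' (S ∩ φ.source) = (W : Set _) ∩ φ.target) :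
    IsMeagre {c | ∃ x ∈ V, f x + M x c ∈ S ∩ φ.source ∧
      LinearMap.range (fderiv ℝ (fun x => f x + M x c) x).toLinearMap ⊔
        tangentSpaceOf S (f x + M x c) ≠ ⊤} := by
  set Ω : Set (EuclideanSpace ℝ (Fin m) × W) :=
    V ×ˢ ((fun w : W => (w : EuclideanSpace ℝ (Fin n))) ⁻¹' φ.target)
  have hΩ : IsOpen Ω := hV.prod (φ.open_target.preimage continuous_subtype_val)
  have hσ : ContDiffOn ℝ ∞ (fun p : EuclideanSpace ℝ (Fin m) × W =>
      φ.symm (p.2 : EuclideanSpace ℝ (Fin n))) Ω :=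
    hs.comp (W.subtypeL.contDiff.comp contDiff_snd).contDiffOn fun p hp => hp.2
  set G : EuclideanSpace ℝ (Fin m) × W → EuclideanSpace ℝ (Fin n) :=
    fun p => (M p.1).inverse (φ.symm (p.2 : EuclideanSpace ℝ (Fin n)) - f p.1)
  have hG : ContDiffOn ℝ ∞ G Ω :=
    contDiffOn_inverse_apply hM hMV contDiff_fst.contDiffOn (fun p hp => hp.1)
      (hσ.sub (hf.comp contDiff_fst).contDiffOn)
  refine (isMeagre_image_criticalSet hΩ hG).mono ?_
  rintro c ⟨x, hx, ⟨hyS, hyφ⟩, hnt⟩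
  have hw : φ (f x + M x c) ∈ (W : Set _) ∩ φ.target :=
    hφS.subset (mem_image_of_mem φ ⟨hyS, hyφ⟩)
  set w : W := ⟨φ (f x + M x c), hw.1⟩
  have hwσ : φ.symm (w : EuclideanSpace ℝ (Fin n)) = f x + M x c := φ.left_inv hyφ
  have hGc : G (x, w) = c := by
    change (M x).inverse (φ.symm (w : EuclideanSpace ℝ (Fin n)) - f x) = c
    rw [hwσ, add_sub_cancel_left, ← ContinuousLinearMap.comp_apply, (hMV x hx).inverse_comp_self]
    rfl
  have hp : (x, w) ∈ Ω := ⟨hx, hw.2⟩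
  refine ⟨(x, w), ⟨hp, fun hsur => hnt ?_⟩, hGc⟩
  -- differentiate the identity `f x' + M x' (G (x', w')) = φ⁻¹ w'`
  have hfx := (hf.differentiable (by simp) x).hasFDerivAt
  have hMx := (hM.differentiable (by simp) x).hasFDerivAt
  have hFc : HasFDerivAt (fun x => f x + M x c) (fderiv ℝ f x + (fderiv ℝ M x).flip c) x := by
    refine (hfx.add (hMx.clm_apply (hasFDerivAt_const c x))).congr_fderiv ?_
    simp
  have hleft : HasFDerivAt (fun p : EuclideanSpace ℝ (Fin m) × W => f p.1 + M p.1 (G p))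
      (fderiv ℝ f x ∘L ContinuousLinearMap.fst ℝ _ _ + ((M x) ∘L fderiv ℝ G (x, w) +
        (fderiv ℝ M x ∘L ContinuousLinearMap.fst ℝ _ _).flip c)) (x, w) := by
    have h1 : HasFDerivAt (fun p : EuclideanSpace ℝ (Fin m) × W => f p.1)
      (fderiv ℝ f x ∘L ContinuousLinearMap.fst ℝ _ _) (x, w) := hfx.comp (x, w) hasFDerivAt_fst
    have h2 : HasFDerivAt (fun p : EuclideanSpace ℝ (Fin m) × W => M p.1)
      (fderiv ℝ M x ∘L ContinuousLinearMap.fst ℝ _ _) (x, w) := hMx.comp (x, w) hasFDerivAt_fst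
    have h3 := h2.clm_apply (hG.hasFDerivAt_of_isOpen hΩ hp)
    rw [hGc] at h3
    exact h1.add h3
  have hright : HasFDerivAt
      (fun p : EuclideanSpace ℝ (Fin m) × W => φ.symm (p.2 : EuclideanSpace ℝ (Fin n)))
      (fderiv ℝ φ.symm w ∘L W.subtypeL ∘L ContinuousLinearMap.snd ℝ _ _) (x, w) :=
    (hs.hasFDerivAt_of_isOpen φ.open_target hw.2).comp (x, w)
      (W.subtypeL.hasFDerivAt.comp (x, w) hasFDerivAt_snd)
  have heq : (fun p : EuclideanSpace ℝ (Fin m) × W => f p.1 + M p.1 (G p)) =ᶠ[𝓝 (x, w)]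
      fun p => φ.symm (p.2 : EuclideanSpace ℝ (Fin n)) := by
    filter_upwards [hΩ.mem_nhds hp] with p hp
    change f p.1 + M p.1 ((M p.1).inverse (φ.symm (p.2 : EuclideanSpace ℝ (Fin n)) - f p.1)) = _
    rw [← ContinuousLinearMap.comp_apply, (hMV p.1 hp.1).self_comp_inverse]
    simp
  have hD := hleft.unique (hright.congr_of_eventuallyEq heq)
  rw [Submodule.eq_top_iff']
  intro v
  obtain ⟨⟨a, b⟩, hab⟩ := hsur ((M x).inverse v)
  have hab' : M x (fderiv ℝ G (x, w) (a, b)) = v := by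
    rw [hab, ← ContinuousLinearMap.comp_apply, (hMV x hx).self_comp_inverse]
    rfl
  have hDab := congrArg
    (fun L : EuclideanSpace ℝ (Fin m) × W →L[ℝ] EuclideanSpace ℝ (Fin n) => L (a, b)) hD
  simp only [add_apply, ContinuousLinearMap.comp_apply,
    ContinuousLinearMap.flip_apply, ContinuousLinearMap.coe_fst', ContinuousLinearMap.coe_snd',
    hab', Submodule.subtypeL_apply] at hDab
  refine Submodule.mem_sup.2 ⟨-(fderiv ℝ f x + (fderiv ℝ M x).flip c) a, ?_,
    fderiv ℝ φ.symm w b, ?_, ?_⟩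
  · rw [hFc.fderiv]
    exact neg_mem ⟨a, rfl⟩
  · have h := fderiv_symm_mem_tangentSpaceOf hs hφS hw.1 hw.2 b.2
    rwa [φ.left_inv hyφ] at h
  · rw [← hDab]
    simp only [add_apply, ContinuousLinearMap.flip_apply]
    abel

theorem isMeagre_perturbations_not_transverse (hmn : m < n) (hf : ContDiff ℝ ∞ f)
    (hM : ContDiff ℝ ∞ M) (hV : IsOpen V) (hMV : ∀ x ∈ V, (M x).IsInvertible)
    (hS : IsSubmanifold k S) :
    IsMeagre {c | ∃ x ∈ V,
      (f x + M x c, fderiv ℝ (fun x => f x + M x c) x) ∉ transverseJets m S} := by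
  choose φ W hy hc hs _ hφS using hS
  obtain ⟨t, htc, ht⟩ := TopologicalSpace.isOpen_iUnion_countable
    (fun y : S => (φ y y.2).source) fun y => (φ y y.2).open_source
  refine ((isMeagre_perturbations_with_zero hmn hf hM hV hMV).union (isMeagre_biUnion htc
    fun y _ => isMeagre_perturbations_not_transverse_in_chart hf hM hV hMV
      (hs y y.2) (hφS y y.2))).mono ?_
  rintro c ⟨x, hx, hxc⟩
  by_cases h0 : f x + M x c = 0
  · exact Or.inl ⟨x, hx, h0⟩
  · simp only [transverseJets, mem_ofPred_eq, not_and, Classical.not_imp] at hxc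
    obtain ⟨hcS, hnt⟩ := hxc h0
    obtain ⟨y, hyt, hys⟩ := mem_iUnion₂.1
      (ht.symm.subset (mem_iUnion.2 ⟨⟨_, hcS⟩, hy _ hcS⟩))
    exact Or.inr (mem_iUnion₂.2 ⟨y, hyt, x, hx, ⟨hcS, hys⟩, hnt⟩)
end

/-! ### Density -/

section
variable {m n k : ℕ} {S : Set (EuclideanSpace ℝ (Fin n))} {E : Submodule ℝ (SmoothMap m n)}

/-- The linear map `c ↦ ∑ i, c i • e i x`. -/
noncomputable def frameMap (e : Fin n → SmoothMap m n) (x : EuclideanSpace ℝ (Fin m)) :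
    EuclideanSpace ℝ (Fin n) →L[ℝ] EuclideanSpace ℝ (Fin n) :=
  ∑ i, (EuclideanSpace.proj i : EuclideanSpace ℝ (Fin n) →L[ℝ] ℝ).smulRight (e i x)

theorem contDiff_frameMap (e : Fin n → SmoothMap m n) : ContDiff ℝ ∞ (frameMap e) := by
  refine ContDiff.sum fun i _ => ?_
  exact (ContinuousLinearMap.smulRightL ℝ _ _
    (EuclideanSpace.proj i : EuclideanSpace ℝ (Fin n) →L[ℝ] ℝ)).contDiff.comp
      (e i).contMDiff.contDiff

theorem frameMap_apply (e : Fin n → SmoothMap m n) (x : EuclideanSpace ℝ (Fin m))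
    (c : EuclideanSpace ℝ (Fin n)) : frameMap e x c = ∑ i, c i • e i x := by
  simp [frameMap]

theorem coe_add_sum_smul (f : SmoothMap m n) (e : Fin n → SmoothMap m n)
    (c : EuclideanSpace ℝ (Fin n)) :
    ⇑(f + ∑ i, c i • e i) = fun x => f x + frameMap e x c := by
  ext1 x
  have h := map_sum (ContMDiffMap.coeFnLinearMap (𝕜 := ℝ)) (fun i => c i • e i) Finset.univ
  rw [frameMap_apply]
  change f x + (∑ i, c i • e i : SmoothMap m n) x = _
  congr 1
  exact (congrFun h x).trans (Finset.sum_apply _ _ _)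

/-- Near each point where the values of `E` fill the target, transversality is dense. -/
theorem exists_nhds_dense_jets (hmn : m < n) (hS : IsSubmanifold k S)
    {x₀ : EuclideanSpace ℝ (Fin m)}
    (hE : (fun f : SmoothMap m n => f x₀) '' (E : Set (SmoothMap m n)) = univ) :
    ∃ V ∈ 𝓝 x₀, Dense {f : E | ∀ x ∈ V, (f.1 x, fderiv ℝ f.1 x) ∈ transverseJets m S} := by
  have := (SmoothMap.withSeminorms_weakSeminorms m n).topologicalAddGroup
  have := (SmoothMap.withSeminorms_weakSeminorms m n).continuousSMul
  have h : ∀ i : Fin n, ∃ e : E, e.1 x₀ = EuclideanSpace.single i 1 := fun i => by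
    obtain ⟨e, he, hex⟩ := hE.symm.subset (mem_univ (EuclideanSpace.single i (1 : ℝ)))
    exact ⟨⟨e, he⟩, hex⟩
  choose e he using h
  set M := frameMap fun i => (e i).1
  have hM : ContDiff ℝ ∞ M := contDiff_frameMap _
  have hM0 : M x₀ = ContinuousLinearMap.id ℝ _ := by
    ext1 c
    refine (frameMap_apply _ _ _).trans ?_
    simp only [he]
    simpa using (EuclideanSpace.basisFun (Fin n) ℝ).sum_repr c
  set V := M ⁻¹' range ContinuousLinearEquiv.toContinuousLinearMap
  have hV : IsOpen V := ContinuousLinearEquiv.isOpen.preimage hM.continuous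
  refine ⟨V, hV.mem_nhds ⟨ContinuousLinearEquiv.refl ℝ _, hM0.symm⟩, fun f => ?_⟩
  let Ψ : EuclideanSpace ℝ (Fin n) → E := fun c => f + ∑ i, c i • e i
  have hΨ : Continuous Ψ := by fun_prop
  have hΨ0 : Ψ 0 = f := by simp [Ψ]
  have hΨc : ∀ c, ⇑(Ψ c).1 = fun x => f.1 x + M x c := fun c => by
    rw [← coe_add_sum_smul]
    simp [Ψ]
  have hd := dense_of_mem_residual (isMeagre_perturbations_not_transverse hmn
    f.1.contMDiff.contDiff hM hV (fun x hx => hx) hS)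
  rw [← hΨ0]
  refine closure_mono ?_ (image_closure_subset_closure_image hΨ (mem_image_of_mem Ψ (hd 0)))
  rintro _ ⟨c, hc, rfl⟩ x hx
  rw [hΨc]
  by_contra hcon
  exact hc ⟨x, hx, hcon⟩

theorem isOpen_jets (hS : IsSubmanifold k S) (hcl : closure S ⊆ S ∪ {0})
    {L : Set (EuclideanSpace ℝ (Fin m))} (hL : IsCompact L) :
    IsOpen {f : E | ∀ x ∈ L, (f.1 x, fderiv ℝ f.1 x) ∈ transverseJets m S} :=
  (SmoothMap.isOpen_setOf_forall_jet_mem hL (isOpen_transverseJets m hS hcl)).preimage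
    continuous_subtype_val

/-- Since transversality along compact sets is an open condition, density passes from small sets to
their finite unions. -/
theorem dense_jets (hmn : m < n) {K : Set (EuclideanSpace ℝ (Fin m))} (hK : IsCompact K)
    (hE : ∀ x ∈ K, (fun f : SmoothMap m n => f x) '' (E : Set (SmoothMap m n)) = univ)
    (hS : IsSubmanifold k S) (hcl : closure S ⊆ S ∪ {0}) :
    Dense {f : E | ∀ x ∈ K, (f.1 x, fderiv ℝ f.1 x) ∈ transverseJets m S} := by
  suffices h : ∃ L, IsCompact L ∧ K ⊆ L ∧
      Dense {f : E | ∀ x ∈ L, (f.1 x, fderiv ℝ f.1 x) ∈ transverseJets m S} by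
    obtain ⟨L, -, hKL, hd⟩ := h
    refine hd.mono ?_
    exact fun f hf x hx => hf x (hKL hx)
  refine hK.induction_on (p := fun A => ∃ L, IsCompact L ∧ A ⊆ L ∧
      Dense {f : E | ∀ x ∈ L, (f.1 x, fderiv ℝ f.1 x) ∈ transverseJets m S}) ?_ ?_ ?_ ?_
  · exact ⟨∅, isCompact_empty, subset_rfl, by simp⟩
  · rintro A B hAB ⟨L, hL, hBL, hd⟩
    exact ⟨L, hL, hAB.trans hBL, hd⟩
  · rintro A B ⟨L, hL, hAL, hd⟩ ⟨L', hL', hBL, hd'⟩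
    refine ⟨L ∪ L', hL.union hL', union_subset_union hAL hBL,
      (hd.inter_of_isOpen_left hd' (isOpen_jets hS hcl hL)).mono ?_⟩
    exact fun f hf x hx => hx.elim (hf.1 x) (hf.2 x)
  · intro x hx
    obtain ⟨V, hV, hd⟩ := exists_nhds_dense_jets hmn hS (hE x hx)
    obtain ⟨L, hL, hLV, hLc⟩ := local_compact_nhds hV
    refine ⟨L, mem_nhdsWithin_of_mem_nhds hL, L, hLc, subset_rfl, hd.mono ?_⟩
    exact fun f hf x hx => hf x (hLV hx)
end

theorem theorem2 (m n k : ℕ) (hmn : m < n)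
    (E : Submodule ℝ (SmoothMap m n))
    (K : Set (EuclideanSpace ℝ (Fin m))) (hK : IsCompact K)
    (hE : ∀ x ∈ K, (fun f : SmoothMap m n => f x) '' (E : Set (SmoothMap m n)) = Set.univ)
    (S : Set (EuclideanSpace ℝ (Fin n))) (hS : IsSubmanifold k S)
    (hcl : closure S ⊆ S ∪ {0}) :
    IsOpen {f : E | (∀ x ∈ K, f.1 x ≠ 0) ∧ TransverseAlong f.1 S K} ∧
      Dense {f : E | (∀ x ∈ K, f.1 x ≠ 0) ∧ TransverseAlong f.1 S K} := by
  have h : {f : E | (∀ x ∈ K, f.1 x ≠ 0) ∧ TransverseAlong f.1 S K} =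
      {f : E | ∀ x ∈ K, (f.1 x, fderiv ℝ f.1 x) ∈ transverseJets m S} := by
    ext f
    exact ⟨fun hf x hx => ⟨hf.1 x hx, hf.2 x hx⟩,
      fun hf => ⟨fun x hx => (hf x hx).1, fun x hx => (hf x hx).2⟩⟩
  rw [h]
  exact ⟨isOpen_jets hS hcl hK, dense_jets hmn hK hE hS hcl⟩
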